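/- Let $k$ be an algebraically closed field of characteristic zero and let $H$ be a Hopf algebra over $k$, with comultiplication $\Delta(h)=\sum h_1\otimes h_2$ and antipode $S$, which is semisimple as an algebra. A Hopf subalgebra of $H$ is a unital subalgebra $B\subseteq H$ with $\Delta(B)\subseteq B\otimes B$ and $S(B)\subseteq B$; it is a Hopf algebra under the restricted structure maps. It is called normal if $\sum h_1\,b\,S(h_2)\in B$ and $\sum S(h_1)\,b\,h_2\in B$ for all $h\in H$ and $b\in B$. Let $A$ and $L$ be normal Hopf subalgebras of $H$ such that $H=AL$ (that is, $H$ is the linear span of the products $al$ with $a\in A$, $l\in L$) and $A\cap L=k\cdot 1_H$. Then the multiplication map $A\otimes_k L\to H$, $a\otimes l\mapsto al$, is an isomorphism of Hopf algebras. -/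

import Mathlib

open scoped TensorProduct

/-- A Hopf subalgebra of a Hopf algebra `H`: a unital subalgebra `A` with `Δ(A) ⊆ A ⊗ A`
(the image of `A ⊗ A` in `H ⊗ H`) and `S(A) ⊆ A`. -/
structure HopfSubalgebra (k H : Type*) [Field k] [Ring H] [HopfAlgebra k H] extends
    Subalgebra k H where
  comul_mem : ∀ a ∈ toSubalgebra, Coalgebra.comul (R := k) a ∈
    (Algebra.TensorProduct.map toSubalgebra.val toSubalgebra.val).range
  antipode_mem : ∀ a ∈ toSubalgebra, HopfAlgebra.antipode k a ∈ toSubalgebra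

namespace HopfSubalgebra

noncomputable section

variable {k H : Type*} [Field k] [Ring H] [HopfAlgebra k H] (A : HopfSubalgebra k H)

theorem map_val_injective :
    Function.Injective (Algebra.TensorProduct.map A.toSubalgebra.val A.toSubalgebra.val) :=
  TensorProduct.map_injective_of_flat_flat A.toSubalgebra.val.toLinearMap
    A.toSubalgebra.val.toLinearMap Subtype.val_injective Subtype.val_injective

theorem map_map_val_injective :
    Function.Injective (Algebra.TensorProduct.map A.toSubalgebra.val
      (Algebra.TensorProduct.map A.toSubalgebra.val A.toSubalgebra.val)) :=
  TensorProduct.map_injective_of_flat_flat A.toSubalgebra.val.toLinearMap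
    (Algebra.TensorProduct.map A.toSubalgebra.val A.toSubalgebra.val).toLinearMap
    Subtype.val_injective A.map_val_injective

/-- The restriction `A → A ⊗ A` of the comultiplication of `H`. -/
def comulAux : A.toSubalgebra →ₐ[k] A.toSubalgebra ⊗[k] A.toSubalgebra :=
  ((AlgEquiv.ofInjective _ A.map_val_injective).symm : _ →ₐ[k] _).comp
    (((Bialgebra.comulAlgHom k H).comp A.toSubalgebra.val).codRestrict _
      fun a => A.comul_mem a a.2)

theorem map_val_comulAux (a : A.toSubalgebra) :
    Algebra.TensorProduct.map A.toSubalgebra.val A.toSubalgebra.val (A.comulAux a) =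
      Coalgebra.comul (R := k) (a : H) :=
  congrArg Subtype.val ((AlgEquiv.ofInjective _ A.map_val_injective).apply_symm_apply
    ⟨Coalgebra.comul (R := k) (a : H), A.comul_mem a a.2⟩)

/-- The restriction `A → k` of the counit of `H`. -/
def counitAux : A.toSubalgebra →ₐ[k] k :=
  (Bialgebra.counitAlgHom k H).comp A.toSubalgebra.val

/-- The restriction `A → A` of the antipode of `H`. -/
def antipodeAux : A.toSubalgebra →ₗ[k] A.toSubalgebra :=
  ((HopfAlgebra.antipode k).comp A.toSubalgebra.val.toLinearMap).codRestrict
    (Subalgebra.toSubmodule A.toSubalgebra) fun a => A.antipode_mem a a.2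

/-- A Hopf subalgebra is a bialgebra with the restricted structure maps. -/
instance instBialgebra : Bialgebra k A.toSubalgebra :=
  Bialgebra.ofAlgHom A.comulAux A.counitAux
    (by
      refine AlgHom.ext fun a => A.map_map_val_injective ?_
      have h1 : ((Algebra.TensorProduct.map A.toSubalgebra.val
          (Algebra.TensorProduct.map A.toSubalgebra.val A.toSubalgebra.val)).comp
          ((Algebra.TensorProduct.assoc k k k A.toSubalgebra A.toSubalgebra
            A.toSubalgebra).toAlgHom.comp
            (Algebra.TensorProduct.map A.comulAux (.id k _)))) =
          ((Algebra.TensorProduct.assoc k k k H H H).toAlgHom.comp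
            (Algebra.TensorProduct.map (Bialgebra.comulAlgHom k H) (.id k H))).comp
            (Algebra.TensorProduct.map A.toSubalgebra.val A.toSubalgebra.val) := by
        have e : (Algebra.TensorProduct.map A.toSubalgebra.val
          (Algebra.TensorProduct.map A.toSubalgebra.val A.toSubalgebra.val)).comp
          (Algebra.TensorProduct.assoc k k k A.toSubalgebra A.toSubalgebra
            A.toSubalgebra).toAlgHom = (Algebra.TensorProduct.assoc k k k H H H).toAlgHom.comp
            (Algebra.TensorProduct.map (Algebra.TensorProduct.map A.toSubalgebra.val
              A.toSubalgebra.val) A.toSubalgebra.val) := by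
          ext <;> simp [Algebra.TensorProduct.one_def]
        rw [← AlgHom.comp_assoc, e]
        ext x
        · simp [A.map_val_comulAux]
        · simp
      have h2 : ((Algebra.TensorProduct.map A.toSubalgebra.val
          (Algebra.TensorProduct.map A.toSubalgebra.val A.toSubalgebra.val)).comp
            (Algebra.TensorProduct.map (.id k _) A.comulAux)) =
            (Algebra.TensorProduct.map (.id k H) (Bialgebra.comulAlgHom k H)).comp
            (Algebra.TensorProduct.map A.toSubalgebra.val A.toSubalgebra.val) := by
        ext x
        · simp
        · simp [A.map_val_comulAux]
      have e1 := DFunLike.congr_fun h1 (A.comulAux a)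
      have e2 := DFunLike.congr_fun h2 (A.comulAux a)
      simp only [AlgHom.comp_apply, map_val_comulAux] at e1 e2 ⊢
      rw [e1, e2]
      exact Coalgebra.coassoc_apply (R := k) (a : H))
    (by
      refine AlgHom.ext fun a => ?_
      apply (Algebra.TensorProduct.lid k A.toSubalgebra).injective
      apply Subtype.val_injective
      have h : A.toSubalgebra.val.comp
          (((Algebra.TensorProduct.lid k A.toSubalgebra) : _ →ₐ[k] _).comp
          (Algebra.TensorProduct.map A.counitAux (.id k _))) =
          ((Algebra.TensorProduct.lid k H : _ →ₐ[k] H).comp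
            (Algebra.TensorProduct.map (Bialgebra.counitAlgHom k H) (.id k H))).comp
            (Algebra.TensorProduct.map A.toSubalgebra.val A.toSubalgebra.val) := by
        ext <;> simp [counitAux]
      have e := DFunLike.congr_fun h (A.comulAux a)
      simp only [AlgHom.comp_apply, map_val_comulAux] at e ⊢
      refine e.trans ?_
      have := Coalgebra.rTensor_counit_comul (R := k) (a : H)
      exact (congrArg (Algebra.TensorProduct.lid k H) this).trans (by simp))
    (by
      refine AlgHom.ext fun a => ?_
      apply (Algebra.TensorProduct.rid k k A.toSubalgebra).injective
      apply Subtype.val_injective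
      have h : A.toSubalgebra.val.comp
          (((Algebra.TensorProduct.rid k k A.toSubalgebra) : _ →ₐ[k] _).comp
          (Algebra.TensorProduct.map (.id k _) A.counitAux)) =
          ((Algebra.TensorProduct.rid k k H : _ →ₐ[k] H).comp
            (Algebra.TensorProduct.map (.id k H) (Bialgebra.counitAlgHom k H))).comp
            (Algebra.TensorProduct.map A.toSubalgebra.val A.toSubalgebra.val) := by
        ext <;> simp [counitAux]
      have e := DFunLike.congr_fun h (A.comulAux a)
      simp only [AlgHom.comp_apply, map_val_comulAux] at e ⊢
      refine e.trans ?_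
      have := Coalgebra.lTensor_counit_comul (R := k) (a : H)
      exact (congrArg (Algebra.TensorProduct.rid k k H) this).trans (by simp))

theorem map_val_comul (a : A.toSubalgebra) :
    TensorProduct.map A.toSubalgebra.val.toLinearMap A.toSubalgebra.val.toLinearMap
      (Coalgebra.comul (R := k) a) = Coalgebra.comul (R := k) (a : H) :=
  A.map_val_comulAux a

theorem counit_coe (a : A.toSubalgebra) :
    Coalgebra.counit (R := k) a = Coalgebra.counit (R := k) (a : H) :=
  rfl

/-- A Hopf subalgebra is a Hopf algebra with the restricted structure maps. -/
instance instHopfAlgebra : HopfAlgebra k A.toSubalgebra where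
  antipode := A.antipodeAux
  mul_antipode_rTensor_comul := by
    refine LinearMap.ext fun a => Subtype.val_injective ?_
    have h : A.toSubalgebra.val.toLinearMap ∘ₗ LinearMap.mul' k A.toSubalgebra ∘ₗ
        A.antipodeAux.rTensor A.toSubalgebra =
        (LinearMap.mul' k H ∘ₗ (HopfAlgebra.antipode k).rTensor H) ∘ₗ
        TensorProduct.map A.toSubalgebra.val.toLinearMap A.toSubalgebra.val.toLinearMap := by
      ext x y
      rfl
    have e := DFunLike.congr_fun h (Coalgebra.comul (R := k) a)
    simp only [LinearMap.comp_apply, map_val_comul] at e ⊢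
    exact e.trans (HopfAlgebra.mul_antipode_rTensor_comul_apply (a : H))
  mul_antipode_lTensor_comul := by
    refine LinearMap.ext fun a => Subtype.val_injective ?_
    have h : A.toSubalgebra.val.toLinearMap ∘ₗ LinearMap.mul' k A.toSubalgebra ∘ₗ
        A.antipodeAux.lTensor A.toSubalgebra =
        (LinearMap.mul' k H ∘ₗ (HopfAlgebra.antipode k).lTensor H) ∘ₗ
        TensorProduct.map A.toSubalgebra.val.toLinearMap A.toSubalgebra.val.toLinearMap := by
      ext x y
      rfl
    have e := DFunLike.congr_fun h (Coalgebra.comul (R := k) a)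
    simp only [LinearMap.comp_apply, map_val_comul] at e ⊢
    exact e.trans (HopfAlgebra.mul_antipode_lTensor_comul_apply (a : H))

theorem coe_antipode (a : A.toSubalgebra) :
    (HopfAlgebra.antipode k a : H) = HopfAlgebra.antipode k (a : H) :=
  rfl

variable (k) in
/-- The left adjoint action `h ↦ h₁ a S(h₂)` on a fixed `a`, as a linear map in `h`. -/
def leftAd (a : H) : H →ₗ[k] H :=
  LinearMap.mul' k H ∘ₗ
    TensorProduct.map (LinearMap.mulRight k a) (HopfAlgebra.antipode k) ∘ₗ Coalgebra.comul

variable (k) in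
/-- The right adjoint action `h ↦ S(h₁) a h₂` on a fixed `a`, as a linear map in `h`. -/
def rightAd (a : H) : H →ₗ[k] H :=
  LinearMap.mul' k H ∘ₗ
    TensorProduct.map (HopfAlgebra.antipode k) (LinearMap.mulLeft k a) ∘ₗ Coalgebra.comul

/-- `A` is normal if `h₁ A S(h₂) ⊆ A` and `S(h₁) A h₂ ⊆ A` for all `h ∈ H`. -/
def IsNormal : Prop :=
  ∀ a ∈ A.toSubalgebra, ∀ h : H,
    leftAd k a h ∈ A.toSubalgebra ∧ rightAd k a h ∈ A.toSubalgebra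

end

end HopfSubalgebra

/-! Commutation: for `a ∈ A`, `l ∈ L` the Hopf commutator `a₁ l₁ S(a₂) S(l₂)` lies in `L` because
`L` is normal and in `A` because `A` is normal, so it is the scalar `ε(a)ε(l)`. Cancelling the
antipodes by convolution gives `al = la` (`commute_of_isNormal`). Multiplication is then a bialgebra
map `π : A ⊗ L → H`, surjective since `H = AL`.

Injectivity needs no dimension count. A coinvariant of `π` has all its contractions in `A ∩ L = k`,
hence is a scalar (`exists_eq_smul_one_of_coinvariant`). Semisimplicity gives a nonzero integral
`lam` on `H` (`exists_integral_ne_zero`). Each `t₁ lam(π(t₂))` is coinvariant, hence scalar, so `lam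
∘ π` is a nonzero integral on `A ⊗ L`. Such a form is nondegenerate
(`eq_zero_of_forall_integral_mul_eq_zero`), while `ker π` lies in its radical. -/

namespace TensorProduct

/-! ### Contractions of tensors -/

noncomputable section

variable {k M N P : Type*} [Field k] [AddCommGroup M] [Module k M] [AddCommGroup N] [Module k N]
  [AddCommGroup P] [Module k P]

/-- Contraction of the left tensor factor with a linear form. -/
def sliceLeft (f : M →ₗ[k] k) : M ⊗[k] N →ₗ[k] N :=
  (TensorProduct.lid k N).toLinearMap ∘ₗ f.rTensor N

/-- Contraction of the right tensor factor with a linear form. -/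
def sliceRight (f : N →ₗ[k] k) : M ⊗[k] N →ₗ[k] M :=
  (TensorProduct.rid k M).toLinearMap ∘ₗ f.lTensor M

/-- Contraction of the left tensor factor of `z`, as a linear map in the linear form. -/
def sliceLeftHom (z : M ⊗[k] N) : (M →ₗ[k] k) →ₗ[k] N where
  toFun f := sliceLeft f z
  map_add' f g := by simp [sliceLeft, LinearMap.rTensor_add]
  map_smul' c f := by simp [sliceLeft, LinearMap.rTensor_smul]

/-- Contraction of the right tensor factor of `z`, as a linear map in the linear form. -/
def sliceRightHom (z : M ⊗[k] N) : (N →ₗ[k] k) →ₗ[k] M where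
  toFun f := sliceRight f z
  map_add' f g := by simp [sliceRight, LinearMap.lTensor_add]
  map_smul' c f := by simp [sliceRight, LinearMap.lTensor_smul]

@[simp]
theorem sliceLeft_tmul (f : M →ₗ[k] k) (m : M) (n : N) : sliceLeft f (m ⊗ₜ[k] n) = f m • n := by
  simp [sliceLeft]

@[simp]
theorem sliceRight_tmul (f : N →ₗ[k] k) (m : M) (n : N) :
    sliceRight f (m ⊗ₜ[k] n) = f n • m := by
  simp [sliceRight]

theorem sliceLeft_lTensor (f : M →ₗ[k] k) (g : N →ₗ[k] P) (z : M ⊗[k] N) :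
    sliceLeft f (g.lTensor M z) = g (sliceLeft f z) := by
  induction z with
  | zero => simp
  | tmul m n => simp
  | add x y hx hy => simp only [map_add, hx, hy]

theorem apply_sliceLeft (f : M →ₗ[k] k) (g : N →ₗ[k] k) (z : M ⊗[k] N) :
    g (sliceLeft f z) = f (sliceRight g z) := by
  induction z with
  | zero => simp
  | tmul m n => simp [mul_comm]
  | add x y hx hy => simp only [map_add, hx, hy]

theorem exists_eq_sum_tmul_sliceLeft (z : M ⊗[k] N) :
    ∃ s : Finset (M × (M →ₗ[k] k)), z = ∑ p ∈ s, p.1 ⊗ₜ[k] sliceLeft p.2 z := by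
  classical
  let b := Module.Basis.ofVectorSpace k M
  have key (i) : sliceLeft (b.coord i) z = TensorProduct.equivFinsuppOfBasisLeft b z i := by
    induction z with
    | zero => simp
    | tmul m n => simp
    | add x y hx hy => simp only [map_add, hx, hy, Finsupp.add_apply]
  refine ⟨(TensorProduct.equivFinsuppOfBasisLeft b z).support.map
    ⟨fun i => (b i, b.coord i), fun i j h => b.injective (congrArg Prod.fst h)⟩, ?_⟩
  conv_lhs => rw [← (TensorProduct.equivFinsuppOfBasisLeft b).symm_apply_apply z]
  rw [TensorProduct.equivFinsuppOfBasisLeft_symm_apply, Finsupp.sum, Finset.sum_map]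
  exact Finset.sum_congr rfl fun i _ => congrArg (b i ⊗ₜ[k] ·) (key i).symm

/-- A tensor is determined by its contractions. -/
theorem ext_sliceLeft {z w : M ⊗[k] N} (h : ∀ f : M →ₗ[k] k, sliceLeft f z = sliceLeft f w) :
    z = w := by
  obtain ⟨s, hs⟩ := exists_eq_sum_tmul_sliceLeft (z - w)
  rw [← sub_eq_zero, hs]
  exact Finset.sum_eq_zero fun i _ => by simp [h]

/-- Contractions of a finite sum of pure tensors lie in the span of its right factors. Applied to
`Δ(t)` for an integral `t`, this makes `H` finite-dimensional. -/
theorem finite_of_sliceLeft_surjective (z : M ⊗[k] N)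
    (h : ∀ n : N, ∃ f : M →ₗ[k] k, sliceLeft f z = n) : Module.Finite k N := by
  classical
  obtain ⟨s, rfl⟩ := TensorProduct.exists_finset z
  refine ⟨⟨s.image Prod.snd, eq_top_iff.2 fun n _ => ?_⟩⟩
  obtain ⟨f, rfl⟩ := h n
  rw [map_sum]
  refine Submodule.sum_mem _ fun i hi => ?_
  rw [sliceLeft_tmul]
  exact Submodule.smul_mem _ _ (Submodule.subset_span (by simpa using ⟨i.1, hi⟩))

end

end TensorProduct

/-! ### Contractions of coproducts -/

namespace Coalgebra

open _root_.TensorProduct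

variable {k C : Type*} [Field k] [AddCommGroup C] [Module k C] [Coalgebra k C]

theorem comul_sliceRight_comul (f : C →ₗ[k] k) (x : C) :
    comul (R := k) (sliceRight f (comul (R := k) x)) =
      (sliceRight f ∘ₗ comul (R := k)).lTensor C (comul (R := k) x) := by
  have h₁ (z : C ⊗[k] C) : comul (R := k) (sliceRight f z) =
      sliceRight f ((comul (R := k)).rTensor C z) := by
    induction z with
    | zero => simp
    | tmul m n => simp
    | add x y hx hy => simp only [map_add, hx, hy]
  have h₂ : (sliceRight f).lTensor C ∘ₗ (_root_.TensorProduct.assoc k C C C).toLinearMap =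
      sliceRight f := by
    ext x y z
    simp
  rw [h₁, LinearMap.lTensor_comp_apply, ← coassoc_apply, ← h₂]
  rfl

theorem sliceLeft_comul_sliceRight_comul (f g : C →ₗ[k] k) (x : C) :
    sliceLeft g (comul (R := k) (sliceRight f (comul (R := k) x))) =
      sliceRight f (comul (R := k) (sliceLeft g (comul (R := k) x))) := by
  rw [comul_sliceRight_comul, sliceLeft_lTensor, LinearMap.comp_apply]

/-- Coassociativity: the form on the right is the convolution `x ↦ f(x₁) g(x₂)`. Hence the
contractions `f(x₁) x₂` of a fixed `x` are stable under further contraction. -/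
theorem sliceLeft_comul_sliceLeft_comul (f g : C →ₗ[k] k) (x : C) :
    sliceLeft g (comul (R := k) (sliceLeft f (comul (R := k) x))) =
      sliceLeft (g ∘ₗ sliceLeft f ∘ₗ comul (R := k)) (comul (R := k) x) := by
  have h₁ (z : C ⊗[k] C) : sliceLeft g (comul (R := k) (sliceLeft f z)) =
      sliceLeft g (sliceLeft f ((comul (R := k)).lTensor C z)) := by
    rw [sliceLeft_lTensor]
  have h₂ : sliceLeft g ∘ₗ sliceLeft f ∘ₗ (_root_.TensorProduct.assoc k C C C).toLinearMap ∘ₗ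
      (comul (R := k)).rTensor C = sliceLeft (g ∘ₗ sliceLeft f ∘ₗ comul (R := k)) := by
    ext x z
    simp only [AlgebraTensorModule.curry_apply, curry_apply, LinearMap.coe_restrictScalars,
      LinearMap.comp_apply, LinearEquiv.coe_coe, LinearMap.rTensor_tmul, sliceLeft_tmul]
    induction comul (R := k) x with
    | zero => simp
    | tmul m n => simp [smul_smul]
    | add x y hx hy => simp only [map_add, add_tmul, hx, hy, add_smul]
  rw [h₁, ← coassoc_apply, ← h₂]
  rfl

theorem sliceLeft_counit_comul (x : C) : sliceLeft (counit (R := k)) (comul (R := k) x) = x := by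
  simp [sliceLeft]

theorem sliceRight_counit_comul (x : C) :
    sliceRight (counit (R := k)) (comul (R := k) x) = x := by
  simp [sliceRight]

end Coalgebra

/-! ### Integrals in and on a Hopf algebra -/

namespace HopfAlgebra

open TensorProduct Coalgebra WithConv

variable {k H : Type*} [Field k] [Ring H] [HopfAlgebra k H]

/-- `S(h₁) h₂ ⊗ h₃ = 1 ⊗ h`. -/
theorem sum_antipode_tmul_one_mul_comul (h : H) {ι : Type*} (r : Repr k h ι) :
    ∑ i ∈ r.index, (antipode k (r.left i) ⊗ₜ[k] (1 : H)) * comul (R := k) (r.right i) =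
      1 ⊗ₜ[k] h := by
  let ι₁ : H →ₐ[k] H ⊗[k] H := Algebra.TensorProduct.includeLeft
  let ι₂ : H →ₐ[k] H ⊗[k] H := Algebra.TensorProduct.includeRight
  have hS : toConv (ι₁.toLinearMap ∘ₗ antipode k) * toConv ι₁.toLinearMap = 1 := by
    have := LinearMap.algHom_comp_convMul_distrib ι₁ (toConv (antipode k)) (toConv LinearMap.id)
    rw [LinearMap.antipode_mul_id] at this
    refine WithConv.ext (this.symm.trans ?_)
    ext
    simp [LinearMap.convOne_def]
  have hΔ : toConv (comul (R := k) (A := H)) =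
      toConv ι₁.toLinearMap * toConv ι₂.toLinearMap := by
    have : LinearMap.mul' k (H ⊗[k] H) ∘ₗ TensorProduct.map ι₁.toLinearMap ι₂.toLinearMap =
        LinearMap.id := by
      ext
      simp [ι₁, ι₂]
    rw [LinearMap.convMul_def]
    exact congrArg toConv (congrArg (· ∘ₗ comul (R := k)) this).symm
  have := congr($(show toConv (ι₁.toLinearMap ∘ₗ antipode k) * toConv (comul (R := k) (A := H)) =
    toConv ι₂.toLinearMap by rw [hΔ, ← mul_assoc, hS, one_mul]) h)
  rw [r.convMul_apply] at this
  simpa [ι₁, ι₂] using this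

/-- A Hopf algebra is simple as a Hopf module over itself: a left ideal which is stable under
`y ↦ f(y₁) y₂` for all linear forms `f` is trivial. -/
theorem eq_bot_or_eq_top_of_isLeftIdeal_of_sliceLeft_mem (Y : Submodule k H)
    (hmul : ∀ (h : H), ∀ y ∈ Y, h * y ∈ Y)
    (hcomul : ∀ (f : H →ₗ[k] k), ∀ y ∈ Y, sliceLeft f (comul (R := k) y) ∈ Y) :
    Y = ⊥ ∨ Y = ⊤ := by
  -- `ε(y) 1 = S(y₁) y₂`, where the right factors `y₂` can be taken in the left ideal `Y`.
  have hone (y : H) (hy : y ∈ Y) : counit (R := k) y • (1 : H) ∈ Y := by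
    obtain ⟨s, hs⟩ := exists_eq_sum_tmul_sliceLeft (comul (R := k) y)
    rw [← Algebra.algebraMap_eq_smul_one, ← mul_antipode_rTensor_comul_apply, hs, map_sum, map_sum]
    exact Submodule.sum_mem _ fun i _ => hmul _ _ (hcomul _ _ hy)
  by_cases h : ∀ y ∈ Y, counit (R := k) y = 0
  · refine Or.inl ((Submodule.eq_bot_iff _).2 fun y hy => ?_)
    obtain ⟨s, hs⟩ := exists_eq_sum_tmul_sliceLeft (comul (R := k) y)
    rw [← sliceRight_counit_comul (k := k) y, hs, map_sum]
    exact Finset.sum_eq_zero fun i _ => by rw [sliceRight_tmul, h _ (hcomul _ _ hy), zero_smul]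
  · push Not at h
    obtain ⟨y, hy, hne⟩ := h
    have h1 : (1 : H) ∈ Y := by
      simpa [smul_smul, inv_mul_cancel₀ hne] using
        Y.smul_mem (counit (R := k) y)⁻¹ (hone y hy)
    exact Or.inr (eq_top_iff.2 fun x _ => by simpa using hmul x 1 h1)

variable (k H) in
/-- A semisimple Hopf algebra has a nonzero left integral. -/
theorem exists_leftIntegral_ne_zero [IsSemisimpleRing H] :
    ∃ t : H, t ≠ 0 ∧ ∀ h : H, h * t = counit (R := k) h • t := by
  let I : Submodule H H := RingHom.ker (Bialgebra.counitAlgHom k H)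
  have hI (x : H) : x ∈ I ↔ counit (R := k) x = 0 := Iff.rfl
  -- The integral is the `J`-component `t` of `1`: the element `(h - ε(h)) t` lies in both `I = ker
  -- ε` and `J`.
  obtain ⟨J, hJ⟩ := exists_isCompl I
  obtain ⟨e, he, t, ht, het⟩ := Submodule.mem_sup.1
    (show (1 : H) ∈ I ⊔ J by rw [hJ.sup_eq_top]; trivial)
  refine ⟨t, ?_, fun h => ?_⟩
  · rintro rfl
    rw [add_zero] at het
    rw [het, hI] at he
    simp at he
  · have hmem : (h - algebraMap k H (counit (R := k) h)) * t ∈ I ⊓ J := by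
      refine ⟨?_, J.smul_mem _ ht⟩
      rw [SetLike.mem_coe, hI]
      simp
    rw [hJ.inf_eq_bot, Submodule.mem_bot, sub_mul, sub_eq_zero] at hmem
    rw [hmem, Algebra.smul_def]

/-- The contractions of the coproduct of a nonzero left integral exhaust the Hopf algebra. -/
theorem exists_sliceLeft_comul_eq {t : H} (ht : t ≠ 0)
    (hint : ∀ h : H, h * t = counit (R := k) h • t) (x : H) :
    ∃ f : H →ₗ[k] k, sliceLeft f (comul (R := k) t) = x := by
  let G := sliceLeftHom (comul (R := k) t)
  have hG (f) : G f = sliceLeft f (comul (R := k) t) := rfl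
  -- `t₁ ⊗ h t₂ = S(h₁) h₂ t₁ ⊗ h₃ t₂ = S(h) t₁ ⊗ t₂`, since `h₂ t = ε(h₂) t`. So the contractions
  -- of `Δ(t)` form a left ideal.
  have hmove (h : H) : (1 ⊗ₜ[k] h) * comul (R := k) t =
      (antipode k h ⊗ₜ[k] 1) * comul (R := k) t := by
    rw [← sum_antipode_tmul_one_mul_comul h (ℛ k h), Finset.sum_mul]
    simp only [mul_assoc, ← Bialgebra.comul_mul, hint, map_smul, mul_smul_comm]
    simp only [← smul_mul_assoc, ← Finset.sum_mul, TensorProduct.smul_tmul',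
      ← TensorProduct.sum_tmul]
    congr 2
    simpa [map_sum, map_smul] using
      congrArg (antipode k) (congrArg (sliceRight (counit (R := k))) (ℛ k h).eq |>.trans
        (sliceRight_counit_comul h))
  have hl (h : H) (f : H →ₗ[k] k) (z : H ⊗[k] H) :
      h * sliceLeft f z = sliceLeft f ((1 ⊗ₜ[k] h) * z) := by
    induction z with
    | zero => simp
    | tmul m n => simp
    | add x y hx hy => simp only [map_add, mul_add, hx, hy]
  have hr (h : H) (f : H →ₗ[k] k) (z : H ⊗[k] H) :
      sliceLeft f ((h ⊗ₜ[k] 1) * z) = sliceLeft (f ∘ₗ LinearMap.mulLeft k h) z := by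
    induction z with
    | zero => simp
    | tmul m n => simp
    | add x y hx hy => simp only [map_add, mul_add, hx, hy]
  have hY := eq_bot_or_eq_top_of_isLeftIdeal_of_sliceLeft_mem (LinearMap.range G)
    (by
      rintro h _ ⟨f, rfl⟩
      exact ⟨f ∘ₗ LinearMap.mulLeft k (antipode k h), by rw [hG, hG, hl, hmove, hr]⟩)
    (by
      rintro g _ ⟨f, rfl⟩
      exact ⟨g ∘ₗ sliceLeft f ∘ₗ comul (R := k),
        by rw [hG, hG, sliceLeft_comul_sliceLeft_comul]⟩)
  have htop : LinearMap.range G = ⊤ := hY.resolve_left fun h => ht <| by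
    have : G (counit (R := k)) ∈ LinearMap.range G := ⟨_, rfl⟩
    rwa [h, Submodule.mem_bot, hG, sliceLeft_counit_comul] at this
  exact LinearMap.range_eq_top.1 htop x

variable (k H) in
/-- A semisimple Hopf algebra carries a nonzero linear form `lam` with `x₁ lam(x₂) = lam(x) 1`. -/
theorem exists_integral_ne_zero [IsSemisimpleRing H] :
    ∃ lam : H →ₗ[k] k, lam ≠ 0 ∧
      ∀ x, sliceRight lam (comul (R := k) x) = lam x • (1 : H) := by
  obtain ⟨t, ht, hint⟩ := exists_leftIntegral_ne_zero k H
  have hsurj := exists_sliceLeft_comul_eq ht hint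
  have : Module.Finite k H := finite_of_sliceLeft_surjective _ hsurj
  let G := sliceLeftHom (comul (R := k) t)
  let F := sliceRightHom (comul (R := k) t)
  have hGinj : Function.Injective G :=
    (LinearMap.injective_iff_surjective_of_finrank_eq_finrank
      (Subspace.dual_finrank_eq (K := k) (V := H))).2 hsurj
  -- `F` and `G` are transposes of each other: a form vanishing on the range of `F` is killed by the
  -- injective `G`.
  have hF : LinearMap.range F = ⊤ := by
    by_contra hne
    obtain ⟨g, hg, hgF⟩ := Submodule.exists_le_ker_of_lt_top _ (lt_top_iff_ne_top.2 hne)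
    refine hg (hGinj ?_)
    rw [map_zero, ← Module.forall_dual_apply_eq_zero_iff k]
    intro f
    exact (apply_sliceLeft g f _).trans (hgF ⟨f, rfl⟩)
  obtain ⟨lam, hlam⟩ := LinearMap.range_eq_top.1 hF 1
  replace hlam : sliceRight lam (comul (R := k) t) = 1 := hlam
  have h1 : (1 : H) ≠ 0 := fun h => ht (by rw [← one_mul t, h, zero_mul])
  refine ⟨lam, ?_, fun x => ?_⟩
  · rintro rfl
    simp [sliceRight] at hlam
    exact h1 hlam.symm
  -- With `x = g(t₁) t₂` and `t₁ lam(t₂) = 1`, both sides equal `g(1) 1`.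
  · obtain ⟨g, rfl⟩ := hsurj x
    rw [← sliceLeft_comul_sliceRight_comul, apply_sliceLeft, hlam, Bialgebra.comul_one,
      Algebra.TensorProduct.one_def, sliceLeft_tmul]

/-- A nonzero integral on a Hopf algebra is nondegenerate. -/
theorem eq_zero_of_forall_integral_mul_eq_zero {lam : H →ₗ[k] k} (hne : lam ≠ 0)
    (hlam : ∀ x, sliceRight lam (comul (R := k) x) = lam x • (1 : H)) {x : H}
    (hx : ∀ s, lam (s * x) = 0) : x = 0 := by
  let N : Submodule k H :=
    { carrier := {n | ∀ s, lam (s * n) = 0}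
      add_mem' := fun ha hb s => by rw [mul_add, map_add, ha, hb, add_zero]
      zero_mem' := fun s => by simp
      smul_mem' := fun c n hn s => by rw [mul_smul_comm, map_smul, hn, smul_zero] }
  -- `n₁ lam(s n₂) = S(s₁) lam(s₂ n)` vanishes for `n ∈ N`, so the radical `N` is stable under
  -- contractions as well as a left ideal.
  have hslice (s n : H) : sliceRight (lam ∘ₗ LinearMap.mulLeft k s) (comul (R := k) n) =
      ∑ i ∈ (ℛ k s).index, lam ((ℛ k s).right i * n) • antipode k ((ℛ k s).left i) := by
    have e₁ (z : H ⊗[k] H) : sliceRight (lam ∘ₗ LinearMap.mulLeft k s) z =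
        sliceRight lam ((1 ⊗ₜ[k] s) * z) := by
      induction z with
      | zero => simp
      | tmul m n => simp
      | add x y hx hy => simp only [map_add, mul_add, hx, hy]
    have e₂ (h : H) (z : H ⊗[k] H) :
        sliceRight lam ((h ⊗ₜ[k] 1) * z) = h * sliceRight lam z := by
      induction z with
      | zero => simp
      | tmul m n => simp
      | add x y hx hy => simp only [map_add, mul_add, hx, hy]
    rw [e₁, ← sum_antipode_tmul_one_mul_comul s (ℛ k s), Finset.sum_mul, map_sum]
    refine Finset.sum_congr rfl fun i _ => ?_
    rw [mul_assoc, ← Bialgebra.comul_mul, e₂, hlam, mul_smul_comm, mul_one]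
  have hN := eq_bot_or_eq_top_of_isLeftIdeal_of_sliceLeft_mem N
    (fun h y hy s => by rw [← mul_assoc]; exact hy _)
    (fun f y hy s => by
      have := apply_sliceLeft f (lam ∘ₗ LinearMap.mulLeft k s) (comul (R := k) y)
      rw [hslice, Finset.sum_eq_zero fun i _ => by rw [hy, zero_smul], map_zero] at this
      exact this)
  have hbot : N = ⊥ := hN.resolve_right fun h => hne <| LinearMap.ext fun y => by
    have : y ∈ N := h ▸ Submodule.mem_top
    simpa using this 1
  have : x ∈ N := hx
  rwa [hbot, Submodule.mem_bot] at this

end HopfAlgebra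

/-! ### Bialgebra maps out of a tensor product -/

namespace BialgHom

open _root_.TensorProduct Coalgebra

variable {k A B H : Type*} [Field k] [Ring A] [Bialgebra k A] [Ring B] [Bialgebra k B]
  [Ring H] [Bialgebra k H]

theorem counitAlgHom_comp_of_tmul (f : A →ₐc[k] H) (g : B →ₐc[k] H) (F : A ⊗[k] B →ₐ[k] H)
    (hF : ∀ a b, F (a ⊗ₜ[k] b) = f a * g b) :
    (Bialgebra.counitAlgHom k H).comp F = Bialgebra.counitAlgHom k (A ⊗[k] B) := by
  ext <;> simp [hF]

theorem map_comp_comulAlgHom_of_tmul (f : A →ₐc[k] H) (g : B →ₐc[k] H) (F : A ⊗[k] B →ₐ[k] H)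
    (hF : ∀ a b, F (a ⊗ₜ[k] b) = f a * g b) :
    (Algebra.TensorProduct.map F F).comp (Bialgebra.comulAlgHom k (A ⊗[k] B)) =
      (Bialgebra.comulAlgHom k H).comp F := by
  ext x
  · have h := CoalgHomClass.map_comp_comul_apply f x
    simp only [AlgHom.comp_apply, Algebra.TensorProduct.includeLeft_apply, hF, map_one, mul_one,
      Bialgebra.comulAlgHom_apply, TensorProduct.comul_tmul, Bialgebra.comul_one,
      Algebra.TensorProduct.one_def, ← h]
    induction comul (R := k) x with
    | zero => simp
    | tmul m n => simp [hF]
    | add x y hx hy => simp only [map_add, add_tmul, hx, hy]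
  · have h := CoalgHomClass.map_comp_comul_apply g x
    simp only [AlgHom.comp_apply, Algebra.TensorProduct.includeRight_apply,
      AlgHom.coe_restrictScalars', hF, map_one, one_mul, Bialgebra.comulAlgHom_apply,
      TensorProduct.comul_tmul, Bialgebra.comul_one, Algebra.TensorProduct.one_def, ← h]
    induction comul (R := k) x with
    | zero => simp
    | tmul m n => simp [hF]
    | add x y hx hy => simp only [map_add, tmul_add, hx, hy]

/-- The bialgebra map `a ⊗ b ↦ f a * g b` for bialgebra maps with commuting images. -/
noncomputable def liftTensor (f : A →ₐc[k] H) (g : B →ₐc[k] H)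
    (hcomm : ∀ a b, Commute (f a) (g b)) : A ⊗[k] B →ₐc[k] H :=
  BialgHom.ofAlgHom (Algebra.TensorProduct.lift (f : A →ₐ[k] H) (g : B →ₐ[k] H) hcomm)
    (counitAlgHom_comp_of_tmul f g _ (Algebra.TensorProduct.lift_tmul _ _ hcomm))
    (map_comp_comulAlgHom_of_tmul f g _ (Algebra.TensorProduct.lift_tmul _ _ hcomm))

@[simp]
theorem liftTensor_tmul (f : A →ₐc[k] H) (g : B →ₐc[k] H)
    (hcomm : ∀ a b, Commute (f a) (g b)) (a : A) (b : B) :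
    liftTensor f g hcomm (a ⊗ₜ[k] b) = f a * g b :=
  Algebra.TensorProduct.lift_tmul _ _ hcomm a b

end BialgHom

/-! ### Commutation of `A` and `L`, and the multiplication map -/

namespace HopfSubalgebra

open TensorProduct Coalgebra HopfAlgebra WithConv

variable {k H : Type*} [Field k] [Ring H] [HopfAlgebra k H]

section

variable (A : HopfSubalgebra k H)

theorem leftAd_eq_sum (x : H) (a : A.toSubalgebra) {ι : Type*} (r : Repr k a ι) :
    leftAd k x (a : H) =
      ∑ i ∈ r.index, (r.left i : H) * x * antipode k (r.right i : H) := by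
  rw [leftAd, LinearMap.comp_apply, LinearMap.comp_apply, ← A.map_val_comul a, ← r.eq]
  simp

/-- Lets an antipode on the right of a convolution product be cancelled against the inclusion of
`A`. -/
theorem val_antipode_mul_val :
    toConv (antipode k ∘ₗ A.toSubalgebra.val.toLinearMap) *
      toConv A.toSubalgebra.val.toLinearMap = 1 := by
  have := LinearMap.algHom_comp_convMul_distrib A.toSubalgebra.val
    (toConv (antipode k)) (toConv LinearMap.id)
  rw [LinearMap.antipode_mul_id] at this
  exact WithConv.ext (this.symm.trans rfl)

theorem counit_leftAd (x h : H) :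
    counit (R := k) (leftAd k x h) = counit (R := k) h * counit (R := k) x := by
  have : leftAd k x h = ∑ i ∈ (ℛ k h).index,
      (ℛ k h).left i * x * antipode k ((ℛ k h).right i) := by
    rw [leftAd, LinearMap.comp_apply, LinearMap.comp_apply, ← (ℛ k h).eq]
    simp
  rw [this, map_sum]
  simp only [Bialgebra.counit_mul, counit_antipode]
  conv_rhs => rw [← sum_counit_smul (ℛ k h), map_sum, Finset.sum_mul]
  exact Finset.sum_congr rfl fun i _ => by simp only [map_smul, smul_eq_mul]; ring

end

variable {A L : HopfSubalgebra k H}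

theorem eq_counit_smul_one_of_mem (hinf : A.toSubalgebra ⊓ L.toSubalgebra = ⊥) {x : H}
    (hA : x ∈ A.toSubalgebra) (hL : x ∈ L.toSubalgebra) : x = counit (R := k) x • 1 := by
  have : x ∈ (⊥ : Subalgebra k H) := hinf ▸ ⟨hA, hL⟩
  obtain ⟨c, rfl⟩ := Algebra.mem_bot.1 this
  rw [Bialgebra.counit_algebraMap, Algebra.algebraMap_eq_smul_one]

/-- `a₁ l S(a₂) = ε(a) l` for `a`, `l` in normal Hopf subalgebras with trivial intersection. -/
theorem leftAd_eq_counit_smul (hA : A.IsNormal) (hL : L.IsNormal)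
    (hinf : A.toSubalgebra ⊓ L.toSubalgebra = ⊥) (a : A.toSubalgebra) (l : L.toSubalgebra) :
    leftAd k (l : H) (a : H) = counit (R := k) a • (l : H) := by
  let D : L.toSubalgebra →ₗ[k] H :=
    { toFun := fun l => leftAd k (l : H) (a : H)
      map_add' := fun x y => by
        simp only [leftAd_eq_sum A _ _ (ℛ k a), ← Finset.sum_add_distrib]
        simp [mul_add, add_mul]
      map_smul' := fun c x => by
        simp only [leftAd_eq_sum A _ _ (ℛ k a)]
        simp [Finset.smul_sum] }
  have hD (l) : D l = leftAd k (l : H) (a : H) := rfl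
  -- The value at `l` is `a₁ l₁ S(a₂) S(l₂)`. Bracketed as `(a₁ l₁ S(a₂)) S(l₂)` it lies in `L`, as
  -- `a₁ (l₁ S(a₂) S(l₂))` in `A`; so it is a scalar, which `ε` computes.
  have hc : toConv D * toConv (antipode k ∘ₗ L.toSubalgebra.val.toLinearMap) =
      counit (R := k) a • (1 : WithConv (L.toSubalgebra →ₗ[k] H)) := by
    refine WithConv.ext (LinearMap.ext fun l => ?_)
    change (toConv D * toConv (antipode k ∘ₗ L.toSubalgebra.val.toLinearMap)) l =
      counit (R := k) a • algebraMap k H (counit (R := k) l)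
    rw [(ℛ k l).convMul_apply]
    change ∑ j ∈ (ℛ k l).index, leftAd k ((ℛ k l).left j : H) (a : H) *
      antipode k ((ℛ k l).right j : H) = _
    rw [eq_counit_smul_one_of_mem (k := k) hinf (x := ∑ j ∈ _, _)]
    · rw [map_sum, Algebra.algebraMap_eq_smul_one, smul_smul]
      congr 1
      conv_rhs => rw [← sum_counit_smul (ℛ k l), map_sum, Finset.mul_sum]
      refine Finset.sum_congr rfl fun j _ => ?_
      rw [Bialgebra.counit_mul, counit_leftAd, counit_antipode, map_smul, smul_eq_mul,
        counit_coe, counit_coe, counit_coe, mul_assoc]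
    · have : ∑ j ∈ (ℛ k l).index, leftAd k ((ℛ k l).left j : H) (a : H) *
          antipode k ((ℛ k l).right j : H) = ∑ i ∈ (ℛ k a).index,
            ((ℛ k a).left i : H) * leftAd k (antipode k ((ℛ k a).right i : H)) (l : H) := by
        simp only [leftAd_eq_sum A _ _ (ℛ k a), leftAd_eq_sum L _ _ (ℛ k l), Finset.sum_mul,
          Finset.mul_sum]
        rw [Finset.sum_comm]
        simp only [mul_assoc]
      rw [this]
      exact sum_mem fun i _ => mul_mem (Subtype.prop _)
        (hA _ (A.antipode_mem _ (Subtype.prop _)) _).1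
    · exact sum_mem fun j _ => mul_mem (hL _ (Subtype.prop _) _).1
        (L.antipode_mem _ (Subtype.prop _))
  have := congrArg (· * toConv L.toSubalgebra.val.toLinearMap) hc
  simp only [mul_assoc, val_antipode_mul_val, mul_one, smul_mul_assoc, one_mul] at this
  exact congr($this l)

/-- Normal Hopf subalgebras with trivial intersection commute elementwise. -/
theorem commute_of_isNormal (hA : A.IsNormal) (hL : L.IsNormal)
    (hinf : A.toSubalgebra ⊓ L.toSubalgebra = ⊥) (a : A.toSubalgebra) (l : L.toSubalgebra) :
    Commute (a : H) (l : H) := by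
  let R : A.toSubalgebra →ₗ[k] H := LinearMap.mulRight k (l : H) ∘ₗ A.toSubalgebra.val.toLinearMap
  have h : toConv R * toConv (antipode k ∘ₗ A.toSubalgebra.val.toLinearMap) =
      toConv ((counit (R := k)).smulRight (l : H)) := by
    refine WithConv.ext (LinearMap.ext fun a => ?_)
    change (toConv R * toConv (antipode k ∘ₗ A.toSubalgebra.val.toLinearMap)) a =
      counit (R := k) a • (l : H)
    rw [(ℛ k a).convMul_apply, ← leftAd_eq_counit_smul hA hL hinf, leftAd_eq_sum A _ _ (ℛ k a)]
    rfl
  -- Convolving `a₁ l S(a₂) = ε(a) l` with the inclusion of `A` turns the left side into `a l` and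
  -- the right side into `ε(a₁) l a₂ = l a`.
  have h' := congr(($h * toConv A.toSubalgebra.val.toLinearMap) a)
  rw [mul_assoc, val_antipode_mul_val, mul_one, (ℛ k a).convMul_apply] at h'
  change (a : H) * (l : H) = (l : H) * (a : H)
  refine h'.trans ?_
  conv_rhs => rw [← sum_counit_smul (ℛ k a)]
  change ∑ i ∈ (ℛ k a).index, (counit (R := k) ((ℛ k a).left i) • (l : H)) *
    ((ℛ k a).right i : H) = _
  simp [Finset.mul_sum]

variable (A) in
/-- The inclusion of a Hopf subalgebra, as a bialgebra map. -/
noncomputable def subtypeBialgHom : A.toSubalgebra →ₐc[k] H :=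
  BialgHom.ofAlgHom A.toSubalgebra.val rfl (AlgHom.ext fun a => A.map_val_comul a)

/-- The multiplication map `A ⊗ L → H` of commuting Hopf subalgebras, as a bialgebra map. -/
noncomputable def mulBialgHom
    (hcomm : ∀ (a : A.toSubalgebra) (l : L.toSubalgebra), Commute (a : H) (l : H)) :
    A.toSubalgebra ⊗[k] L.toSubalgebra →ₐc[k] H :=
  A.subtypeBialgHom.liftTensor L.subtypeBialgHom hcomm

@[simp]
theorem mulBialgHom_tmul
    (hcomm : ∀ (a : A.toSubalgebra) (l : L.toSubalgebra), Commute (a : H) (l : H))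
    (a : A.toSubalgebra) (l : L.toSubalgebra) :
    mulBialgHom hcomm (a ⊗ₜ[k] l) = (a : H) * (l : H) :=
  BialgHom.liftTensor_tmul _ _ hcomm a l

theorem mulBialgHom_surjective
    (hcomm : ∀ (a : A.toSubalgebra) (l : L.toSubalgebra), Commute (a : H) (l : H))
    (hAL : Subalgebra.toSubmodule A.toSubalgebra * Subalgebra.toSubmodule L.toSubalgebra = ⊤) :
    Function.Surjective (mulBialgHom hcomm) := by
  intro x
  have hx : x ∈ Subalgebra.toSubmodule A.toSubalgebra *
    Subalgebra.toSubmodule L.toSubalgebra := hAL ▸ Submodule.mem_top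
  induction hx using Submodule.mul_induction_on' with
  | mem_mul_mem a ha l hl => exact ⟨⟨a, ha⟩ ⊗ₜ[k] ⟨l, hl⟩, by simp⟩
  | add x _ y _ hx hy =>
    obtain ⟨x, rfl⟩ := hx
    obtain ⟨y, rfl⟩ := hy
    exact ⟨x + y, map_add _ _ _⟩

end HopfSubalgebra

/-! ### Coproduct identities for the coinvariant computation -/

namespace Coalgebra

open _root_.TensorProduct WithConv

variable {k C D : Type*} [Field k]

theorem comul_tmul_eq_sum [AddCommGroup C] [Module k C] [Coalgebra k C] [AddCommGroup D]
    [Module k D] [Coalgebra k D] {c : C} {d : D} {ι κ : Type*} (r : Repr k c ι)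
    (s : Repr k d κ) :
    comul (R := k) (c ⊗ₜ[k] d) = ∑ i ∈ r.index, ∑ j ∈ s.index,
      (r.left i ⊗ₜ[k] s.left j) ⊗ₜ[k] (r.right i ⊗ₜ[k] s.right j) := by
  rw [_root_.TensorProduct.comul_tmul, ← r.eq, ← s.eq]
  simp only [sum_tmul, tmul_sum, map_sum]
  rw [Finset.sum_comm]
  rfl

/-- `a₁ ⊗ f'(a₂) f(a₃) = a ⊗ 1` if `f'` is a left convolution inverse of `f`. -/
theorem sum_lTensor_comul_mul_of_convMul_eq_one {A H : Type*} [Ring A] [Bialgebra k A] [Ring H]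
    [Algebra k H] {f' f : A →ₗ[k] H} (hf : toConv f' * toConv f = 1) {a : A} {ι : Type*}
    (r : Repr k a ι) :
    ∑ i ∈ r.index, f'.lTensor A (comul (R := k) (r.left i)) * (1 ⊗ₜ[k] f (r.right i)) =
      a ⊗ₜ[k] 1 := by
  let ι₁ : A →ₐ[k] A ⊗[k] H := Algebra.TensorProduct.includeLeft
  let ι₂ : H →ₐ[k] A ⊗[k] H := Algebra.TensorProduct.includeRight
  have hS : toConv (ι₂.toLinearMap ∘ₗ f') * toConv (ι₂.toLinearMap ∘ₗ f) = 1 := by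
    have := LinearMap.algHom_comp_convMul_distrib ι₂ (toConv f') (toConv f)
    rw [hf] at this
    refine WithConv.ext (this.symm.trans ?_)
    ext
    simp [LinearMap.convOne_def]
  have hg : toConv (f'.lTensor A ∘ₗ comul (R := k)) =
      toConv ι₁.toLinearMap * toConv (ι₂.toLinearMap ∘ₗ f') := by
    have : LinearMap.mul' k (A ⊗[k] H) ∘ₗ
        _root_.TensorProduct.map ι₁.toLinearMap (ι₂.toLinearMap ∘ₗ f') = f'.lTensor A := by
      ext
      simp [ι₁, ι₂]
    rw [LinearMap.convMul_def]
    exact congrArg toConv (congrArg (· ∘ₗ comul (R := k)) this).symm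
  have := congr($(show toConv (f'.lTensor A ∘ₗ comul (R := k)) *
    toConv (ι₂.toLinearMap ∘ₗ f) = toConv ι₁.toLinearMap by rw [hg, mul_assoc, hS, mul_one]) a)
  rw [r.convMul_apply] at this
  exact this

end Coalgebra

/-! ### Injectivity from trivial coinvariants -/

namespace HopfAlgebra

open TensorProduct Coalgebra WithConv

variable {k T H : Type*} [Field k] [Ring T] [HopfAlgebra k T] [Ring H] [HopfAlgebra k H]

/-- For an integral `lam` on `H`, the elements `t₁ lam(π(t₂))` are coinvariant. -/
theorem lTensor_comul_sliceRight_comp (π : T →ₐc[k] H) {lam : H →ₗ[k] k}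
    (hlam : ∀ x, sliceRight lam (comul (R := k) x) = lam x • (1 : H)) (t : T) :
    (π : T →ₗ[k] H).lTensor T
        (comul (R := k) (sliceRight (lam ∘ₗ (π : T →ₗ[k] H)) (comul (R := k) t))) =
      sliceRight (lam ∘ₗ (π : T →ₗ[k] H)) (comul (R := k) t) ⊗ₜ[k] 1 := by
  have h (z : T ⊗[k] T) : (π : T →ₗ[k] H) (sliceRight (lam ∘ₗ (π : T →ₗ[k] H)) z) =
      sliceRight lam (TensorProduct.map (π : T →ₗ[k] H) (π : T →ₗ[k] H) z) := by
    induction z with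
    | zero => simp
    | tmul m n => simp
    | add x y hx hy => simp only [map_add, hx, hy]
  -- As `π` respects coproducts, `π(x₁) lam(π(x₂))` is the integral identity at `π(x)`.
  have hπ : (π : T →ₗ[k] H) ∘ₗ sliceRight (lam ∘ₗ (π : T →ₗ[k] H)) ∘ₗ comul (R := k) =
      (lam ∘ₗ (π : T →ₗ[k] H)).smulRight (1 : H) := by
    ext x
    simp only [LinearMap.comp_apply, LinearMap.smulRight_apply]
    rw [h, ← hlam]
    exact congrArg _ (CoalgHomClass.map_comp_comul_apply π x)
  rw [comul_sliceRight_comul, ← LinearMap.lTensor_comp_apply, hπ]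
  induction comul (R := k) t with
  | zero => simp
  | tmul m n => simp [TensorProduct.smul_tmul']
  | add x y hx hy => simp only [map_add, add_tmul, hx, hy]

/-- A surjective map of Hopf algebras with trivial coinvariants is injective if its target carries
a nonzero integral. -/
theorem injective_of_coinvariants_trivial (π : T →ₐc[k] H) (hsurj : Function.Surjective π)
    (hco : ∀ u : T, (π : T →ₗ[k] H).lTensor T (comul (R := k) u) = u ⊗ₜ[k] 1 →
      ∃ c : k, u = c • 1)
    {lam : H →ₗ[k] k} (hne : lam ≠ 0)
    (hlam : ∀ x, sliceRight lam (comul (R := k) x) = lam x • (1 : H)) :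
    Function.Injective π := by
  rw [injective_iff_map_eq_zero]
  intro t ht
  refine eq_zero_of_forall_integral_mul_eq_zero (lam := lam ∘ₗ (π : T →ₗ[k] H)) ?_ ?_ ?_
  · intro h
    refine hne (LinearMap.ext fun x => ?_)
    obtain ⟨x, rfl⟩ := hsurj x
    exact congr($h x)
  · intro x
    obtain ⟨c, hc⟩ := hco _ (lTensor_comul_sliceRight_comp π hlam x)
    have hε : counit (R := k) (sliceRight (lam ∘ₗ (π : T →ₗ[k] H)) (comul (R := k) x)) =
        (lam ∘ₗ (π : T →ₗ[k] H)) x := by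
      rw [← apply_sliceLeft, sliceLeft_counit_comul]
    rw [hc] at hε ⊢
    rw [← hε]
    simp
  · intro s
    simp [ht]

end HopfAlgebra

/-! ### Coinvariants of the multiplication map -/

namespace HopfSubalgebra

open TensorProduct Coalgebra HopfAlgebra WithConv

variable {k H : Type*} [Field k] [Ring H] [HopfAlgebra k H] {A L : HopfSubalgebra k H}

/-- An element of `A ⊗ L` which is coinvariant for the multiplication map is determined by its
image under `id ⊗ ε`. -/
theorem lTensor_val_eq_of_coinvariant
    (hcomm : ∀ (a : A.toSubalgebra) (l : L.toSubalgebra), Commute (a : H) (l : H))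
    (u : A.toSubalgebra ⊗[k] L.toSubalgebra)
    (hu : (mulBialgHom hcomm : _ →ₗ[k] H).lTensor _ (comul (R := k) u) = u ⊗ₜ[k] 1) :
    L.toSubalgebra.val.toLinearMap.lTensor A.toSubalgebra u =
      (antipode k ∘ₗ A.toSubalgebra.val.toLinearMap).lTensor A.toSubalgebra
        (comul (R := k) (sliceRight (counit (R := k)) u)) := by
  let g : A.toSubalgebra →ₗ[k] A.toSubalgebra ⊗[k] H :=
    (antipode k ∘ₗ A.toSubalgebra.val.toLinearMap).lTensor A.toSubalgebra ∘ₗ comul (R := k)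
  let ι₂ : H →ₐ[k] A.toSubalgebra ⊗[k] H := Algebra.TensorProduct.includeRight
  -- `Ψ` sends `a ⊗ l ⊗ h` to `ε(l) a₁ ⊗ S(a₂) h`. On `(id ⊗ π) Δ(a ⊗ l)` it gives `a₁ ⊗ S(a₂) a₃ l
  -- = a ⊗ l`; on `u ⊗ 1` it gives the right side of the claim.
  let Ψ : (A.toSubalgebra ⊗[k] L.toSubalgebra) ⊗[k] H →ₗ[k] A.toSubalgebra ⊗[k] H :=
    LinearMap.mul' k (A.toSubalgebra ⊗[k] H) ∘ₗ
      TensorProduct.map (g ∘ₗ sliceRight (counit (R := k))) ι₂.toLinearMap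
  have hΨ (w : A.toSubalgebra ⊗[k] L.toSubalgebra) (h : H) :
      Ψ (w ⊗ₜ[k] h) = g (sliceRight (counit (R := k)) w) * (1 ⊗ₜ[k] h) := rfl
  have key (w : A.toSubalgebra ⊗[k] L.toSubalgebra) :
      Ψ ((mulBialgHom hcomm : _ →ₗ[k] H).lTensor _ (comul (R := k) w)) =
        L.toSubalgebra.val.toLinearMap.lTensor A.toSubalgebra w := by
    induction w with
    | zero => simp only [map_zero]
    | add x y hx hy => simp only [map_add, hx, hy]
    | tmul a l =>
      have hl : ∑ j ∈ (ℛ k l).index,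
          counit (R := k) ((ℛ k l).left j) • ((ℛ k l).right j : H) = l := by
        conv_rhs => rw [← sum_counit_smul (ℛ k l)]
        simp
      have hterm (i j) : Ψ ((mulBialgHom hcomm : _ →ₗ[k] H).lTensor _
          (((ℛ k a).left i ⊗ₜ[k] (ℛ k l).left j) ⊗ₜ[k]
            ((ℛ k a).right i ⊗ₜ[k] (ℛ k l).right j))) =
          g ((ℛ k a).left i) * (1 ⊗ₜ[k] ((ℛ k a).right i : H)) *
            (1 ⊗ₜ[k] (counit (R := k) ((ℛ k l).left j) • ((ℛ k l).right j : H))) := by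
        rw [LinearMap.lTensor_tmul, hΨ, sliceRight_tmul, map_smul, mul_assoc,
          Algebra.TensorProduct.tmul_mul_tmul, one_mul, mul_smul_comm, tmul_smul, mul_smul_comm,
          smul_mul_assoc]
        exact congrArg (fun x => _ • (_ * 1 ⊗ₜ[k] x)) (mulBialgHom_tmul hcomm _ _)
      simp only [comul_tmul_eq_sum (ℛ k a) (ℛ k l), map_sum, hterm]
      simp only [← Finset.mul_sum, ← tmul_sum, hl, ← Finset.sum_mul]
      have ha := sum_lTensor_comul_mul_of_convMul_eq_one A.val_antipode_mul_val (ℛ k a)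
      refine (congrArg (· * ((1 : A.toSubalgebra) ⊗ₜ[k] (l : H))) ha).trans ?_
      simp
  rw [← key u, hu, hΨ, ← Algebra.TensorProduct.one_def, mul_one]
  rfl

theorem exists_eq_smul_one_of_coinvariant (hinf : A.toSubalgebra ⊓ L.toSubalgebra = ⊥)
    (hcomm : ∀ (a : A.toSubalgebra) (l : L.toSubalgebra), Commute (a : H) (l : H))
    (u : A.toSubalgebra ⊗[k] L.toSubalgebra)
    (hu : (mulBialgHom hcomm : _ →ₗ[k] H).lTensor _ (comul (R := k) u) = u ⊗ₜ[k] 1) :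
    ∃ c : k, u = c • 1 := by
  set x := sliceRight (counit (R := k)) u
  -- The contraction lies in `L` by its type, and in `S(A) ⊆ A` by the preceding formula.
  have hslice (f : A.toSubalgebra →ₗ[k] k) :
      sliceLeft f u = counit (R := k) (sliceLeft f u) • 1 := by
    have h := congrArg (sliceLeft f) (lTensor_val_eq_of_coinvariant hcomm u hu)
    rw [sliceLeft_lTensor, sliceLeft_lTensor] at h
    refine Subtype.ext (eq_counit_smul_one_of_mem hinf ?_ (Subtype.prop _))
    refine (show ((sliceLeft f u : L.toSubalgebra) : H) = _ from h) ▸ ?_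
    exact A.antipode_mem _ (Subtype.prop _)
  have hux : u = x ⊗ₜ[k] 1 := by
    refine ext_sliceLeft fun f => ?_
    rw [hslice f, sliceLeft_tmul, apply_sliceLeft]
  -- Applying `ε ⊗ id` to coinvariance gives `π(u) = ε(u) 1`, while `u = x ⊗ 1` gives `π(u) = x`.
  have hπ : (x : H) = counit (R := k) u • 1 := by
    have h := congrArg (sliceLeft (counit (R := k))) hu
    rw [sliceLeft_lTensor, sliceLeft_counit_comul, sliceLeft_tmul] at h
    rw [← h]
    exact ((congrArg (mulBialgHom hcomm) hux).trans
      ((mulBialgHom_tmul hcomm _ _).trans (mul_one _))).symm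
  refine ⟨counit (R := k) u, ?_⟩
  have hx1 : x = counit (R := k) u • 1 := Subtype.ext hπ
  rw [Algebra.TensorProduct.one_def, TensorProduct.smul_tmul', ← hx1]
  exact hux

end HopfSubalgebra

/-! ### The isomorphism -/

theorem theorem3p5 {k H : Type*} [Field k] [IsAlgClosed k] [CharZero k]
    [Ring H] [HopfAlgebra k H] [IsSemisimpleRing H]
    (A L : HopfSubalgebra k H) (hA : A.IsNormal) (hL : L.IsNormal)
    (hAL : Subalgebra.toSubmodule A.toSubalgebra * Subalgebra.toSubmodule L.toSubalgebra = ⊤)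
    (hinf : A.toSubalgebra ⊓ L.toSubalgebra = ⊥) :
    ∃ φ : (A.toSubalgebra ⊗[k] L.toSubalgebra) ≃ₐc[k] H,
      (∀ (a : A.toSubalgebra) (l : L.toSubalgebra), φ (a ⊗ₜ[k] l) = (a : H) * (l : H)) ∧
      ∀ x : A.toSubalgebra ⊗[k] L.toSubalgebra,
        φ (HopfAlgebra.antipode k x) = HopfAlgebra.antipode k (φ x) := by
  have hcomm := HopfSubalgebra.commute_of_isNormal hA hL hinf
  obtain ⟨lam, hne, hlam⟩ := HopfAlgebra.exists_integral_ne_zero k H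
  have hsurj := HopfSubalgebra.mulBialgHom_surjective hcomm hAL
  have hinj := HopfAlgebra.injective_of_coinvariants_trivial _ hsurj
    (HopfSubalgebra.exists_eq_smul_one_of_coinvariant hinf hcomm) hne hlam
  let φ := BialgEquiv.ofBijective (HopfSubalgebra.mulBialgHom hcomm) ⟨hinj, hsurj⟩
  have hφ (a : A.toSubalgebra) (l : L.toSubalgebra) : φ (a ⊗ₜ[k] l) = (a : H) * (l : H) :=
    HopfSubalgebra.mulBialgHom_tmul hcomm a l
  refine ⟨φ, hφ, fun x => ?_⟩
  induction x with
  | zero => simp only [map_zero]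
  | add x y hx hy => simp only [map_add, hx, hy]
  | tmul a l =>
    -- The antipode of `H` reverses the product; commutation of `A` and `L` restores the order.
    rw [hφ, HopfAlgebra.antipode_mul_antidistrib]
    refine (hφ (HopfAlgebra.antipode k a) (HopfAlgebra.antipode k l)).trans ?_
    exact (hcomm _ _).eq
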